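/- Let $G$ be a group and $\varphi$ an endomorphism of $G$. Two elements $x, y \in G$ are called $\varphi$-conjugate if $x = z y \varphi(z)^{-1}$ for some $z \in G$; this is an equivalence relation on $G$, and the number of its equivalence classes, $R(\varphi) \in \{1, 2, 3, \ldots\} \cup \{\infty\}$, is called the Reidemeister number of $\varphi$. Theorem. Let $N$ be a finitely generated torsion-free nilpotent group and let $H$ be a subgroup of finite index in $N$. Let $\varphi$ be an endomorphism of $N$ such that $\varphi(H) \le H$, and let $\varphi|_H$ denote its restriction to an endomorphism of $H$. Then $R(\varphi|_H) = R(\varphi)$ (in particular, one of the two is infinite if and only if the other is). -/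

import Mathlib

namespace TwistedConjugacy

/-- Elements `x`, `y` of a group are `φ`-conjugate if `x = z y φ(z)⁻¹` for some `z`. -/
def IsTwistedConj {G : Type*} [Group G] (φ : G →* G) (x y : G) : Prop :=
  ∃ z : G, x = z * y * (φ z)⁻¹

/-- `φ`-conjugacy is an equivalence relation. -/
theorem isTwistedConj_equivalence {G : Type*} [Group G] (φ : G →* G) :
    Equivalence (IsTwistedConj φ) where
  refl x := ⟨1, by simp⟩
  symm := by
    rintro x y ⟨z, rfl⟩
    exact ⟨z⁻¹, by simp [mul_assoc]⟩
  trans := by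
    rintro x y w ⟨z, rfl⟩ ⟨t, rfl⟩
    exact ⟨z * t, by simp [mul_assoc]⟩

/-- The setoid of `φ`-conjugacy. -/
def twistedConjSetoid {G : Type*} [Group G] (φ : G →* G) : Setoid G :=
  ⟨IsTwistedConj φ, isTwistedConj_equivalence φ⟩

/-- The Reidemeister number `R(φ)`: the number of `φ`-conjugacy classes, a natural number or `∞`. -/
noncomputable def reidemeisterNumber {G : Type*} [Group G] (φ : G →* G) : ℕ∞ :=
  ENat.card (Quotient (twistedConjSetoid φ))

/-- The restriction of an endomorphism `φ` of `G` to an endomorphism of a subgroup `H`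
with `φ(H) ≤ H`. -/
def restrictEnd {G : Type*} [Group G] (φ : G →* G) (H : Subgroup G) (h : H.map φ ≤ H) :
    H →* H :=
  (φ.domRestrict H).codRestrict H fun x => h (Subgroup.mem_map_of_mem φ x.2)

end TwistedConjugacy

/-!
The proof is an induction along the lower central series. If the `k + 1`-st term of the lower
central series of `G` is trivial, let `Z` be the set of central elements with a positive power in
the `k`-th term. As the centre of a torsion-free nilpotent group is isolated
(`mem_center_of_pow_mem`), `Z` consists of all roots of elements of the `k`-th term; hence it is
invariant under every endomorphism and `G ⧸ Z` is again torsion-free. Moreover `Z` has finite rank,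
because the `k`-th term is finitely generated (`exists_central_reduction`).

Let `φ` induce `ψ` on `G ⧸ Z`. The fibre of the map from `φ`-classes to `ψ`-classes over the class
of `x` is in bijection with the `φ`-classes of `Z` whenever the twisted stabilizer
`{g | g x ψ(g)⁻¹ = x}` is trivial, so if all of these are trivial then `R(φ) = R(ψ) R(φ|_Z)`
(`reidemeisterNumber_eq_mul`). Finiteness of the Reidemeister number forces this triviality
(`twistedStabilizer_eq_one`): for an abelian group of finite rank it says that an endomorphism
`1 - φ` with image of finite index is injective, and the general case follows through the product
formula.

For a subgroup `H` of finite index, either `R(ψ)` is infinite, and then so are `R(φ)` and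
`R(φ|_H)`, which surject onto `R(ψ)` and `R(ψ|_{HZ/Z}) = R(ψ)` respectively; or the twisted
stabilizers in `G ⧸ Z`, and a fortiori in `HZ/Z`, are trivial, and the product formula for `G` and
for `H` reduces the claim to the abelian group `Z` and its subgroup `H ∩ Z`. There it is the
multiplicativity of the index: for injective `f = 1 - φ` and `B` of finite index in `A`, both
`[A : f A] [f A : f B]` and `[A : B] [B : f B]` equal `[A : f B]`, and `[f A : f B] = [A : B]`
(`reidemeisterNumber_restrictEnd_comm`).
-/

namespace TwistedConjugacy

open Subgroup
open scoped commutatorElement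

/-! ### Reidemeister numbers along surjections -/

theorem reidemeisterNumber_le_of_surjective {G Q : Type*} [Group G] [Group Q] {φ : G →* G}
    {ψ : Q →* Q} (π : G →* Q) (hπ : Function.Surjective π) (hφψ : ∀ g, π (φ g) = ψ (π g)) :
    reidemeisterNumber ψ ≤ reidemeisterNumber φ := by
  let F : Quotient (twistedConjSetoid φ) → Quotient (twistedConjSetoid ψ) :=
    Quotient.map π (by
      rintro _ y ⟨z, rfl⟩
      exact ⟨π z, by simp [hφψ]⟩)
  have hF : Function.Surjective F := by
    intro q
    induction q using Quotient.inductionOn with | _ q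
    obtain ⟨g, rfl⟩ := hπ q
    exact ⟨⟦g⟧, rfl⟩
  exact ENat.card_le_card_of_injective (Function.injective_surjInv hF)

theorem reidemeisterNumber_congr {G Q : Type*} [Group G] [Group Q] {φ : G →* G}
    {ψ : Q →* Q} (e : G ≃* Q) (he : ∀ g, e (φ g) = ψ (e g)) :
    reidemeisterNumber φ = reidemeisterNumber ψ := by
  refine le_antisymm
    (reidemeisterNumber_le_of_surjective e.symm.toMonoidHom e.symm.surjective fun q => ?_)
    (reidemeisterNumber_le_of_surjective e.toMonoidHom e.surjective he)
  exact e.injective (by simp [he])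

/-- The product formula. Choose a lift `s` of each `ψ`-class; then every `φ`-class contains some
`k * s` with `k ∈ K`, and since the twisted stabilizers in `Q` are trivial, `k * s` and `k' * s` are
`φ`-conjugate only through an element of `K`, which is central. -/
theorem reidemeisterNumber_eq_mul {G Q : Type*} [Group G] [Group Q] {φ : G →* G} {ψ : Q →* Q}
    (π : G →* Q) (hπ : Function.Surjective π) (hφψ : ∀ g, π (φ g) = ψ (π g))
    (hstab : ∀ x g : Q, g * x * (ψ g)⁻¹ = x → g = 1)
    {K : Subgroup G} (hK : π.ker = K) (hc : K ≤ center G) (hφK : K.map φ ≤ K) :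
    reidemeisterNumber φ = reidemeisterNumber ψ * reidemeisterNumber (restrictEnd φ K hφK) := by
  have mem_K : ∀ g, g ∈ K ↔ π g = 1 := fun g => by rw [← hK, MonoidHom.mem_ker]
  have hcomm : ∀ k ∈ K, ∀ g, k * g = g * k := fun k hk g => (mem_center_iff.1 (hc hk) g).symm
  have hφmem : ∀ k ∈ K, φ k ∈ K := fun k hk => hφK (mem_map_of_mem φ hk)
  choose s hs using hπ
  let F : Quotient (twistedConjSetoid ψ) × Quotient (twistedConjSetoid (restrictEnd φ K hφK)) →
      Quotient (twistedConjSetoid φ) := fun p => ⟦(p.2.out : G) * s p.1.out⟧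
  have hF : Function.Bijective F := by
    constructor
    · rintro ⟨q, k⟩ ⟨q', k'⟩ h
      obtain ⟨z, hz⟩ : IsTwistedConj φ _ _ := Quotient.exact h
      dsimp only at hz
      have hπz : q.out = π z * q'.out * (ψ (π z))⁻¹ := by
        have := congrArg π hz
        simpa [hφψ, hs, (mem_K _).1 k.out.2, (mem_K _).1 k'.out.2] using this
      have hq : q = q' := by
        rw [← q.out_eq, ← q'.out_eq]
        exact Quotient.sound ⟨π z, hπz⟩
      subst hq
      -- triviality of the twisted stabilizers forces the conjugating element into the kernel
      have hzK : z ∈ K := (mem_K z).2 (hstab _ _ hπz.symm)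
      have hk : k = k' := by
        rw [← k.out_eq, ← k'.out_eq]
        refine Quotient.sound ⟨⟨z, hzK⟩, Subtype.ext ?_⟩
        refine mul_right_cancel (b := s q.out) (hz.trans ?_)
        change _ = z * k'.out * (φ z)⁻¹ * s q.out
        rw [mul_assoc (z * (k'.out : G)), hcomm _ (K.inv_mem (hφmem z hzK))]
        simp only [mul_assoc]
      rw [hk]
    · intro y
      induction y using Quotient.inductionOn with | _ y
      obtain ⟨q, hq⟩ : ∃ q : Quotient (twistedConjSetoid ψ), q = ⟦π y⟧ := ⟨_, rfl⟩
      obtain ⟨w, hw⟩ : IsTwistedConj ψ q.out (π y) :=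
        Quotient.exact (q.out_eq.trans hq)
      have hk : s w * y * (φ (s w))⁻¹ * (s q.out)⁻¹ ∈ K := by
        rw [mem_K]
        simp [hφψ, hs, hw]
      set k : K := ⟨_, hk⟩ with hkdef
      let k' : Quotient (twistedConjSetoid (restrictEnd φ K hφK)) := ⟦k⟧
      obtain ⟨z, hz⟩ : IsTwistedConj (restrictEnd φ K hφK) k'.out k :=
        Quotient.exact k'.out_eq
      have hz' : (k'.out : G) = z * k * (φ z)⁻¹ := congrArg Subtype.val hz
      refine ⟨(q, k'), Quotient.sound ⟨z * s w, ?_⟩⟩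
      change (k'.out : G) * s q.out = _
      rw [hz', mul_assoc (_ * _), hcomm _ (K.inv_mem (hφmem z z.2))]
      simp [hkdef, mul_assoc]
  rw [reidemeisterNumber, ← ENat.card_congr (Equiv.ofBijective F hF), ENat.card_prod]
  rfl

/-! ### Abelian groups of finite rank -/

section Abelian

open Cardinal

/-- An abelian group that is torsion over a finitely generated subgroup has finite rank. -/
theorem rank_int_lt_aleph0_of_pow_mem_fg {A : Type*} [CommGroup A] {B : Subgroup A} (hB : B.FG)
    (h : ∀ a : A, ∃ n, 0 < n ∧ a ^ n ∈ B) : Module.rank ℤ (Additive A) < ℵ₀ := by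
  let M : Submodule ℤ (Additive A) := B.toAddSubgroup.toIntSubmodule
  have hM : M.FG := by
    rw [Submodule.fg_iff_addSubgroup_fg]
    exact (Subgroup.fg_iff_add_fg B).1 hB
  have : Module.Finite ℤ M := Module.Finite.iff_fg.2 hM
  have hq : Module.rank ℤ (Additive A ⧸ M) = 0 := by
    rw [Module.rank_eq_zero_iff_isTorsion]
    intro x
    induction x using Submodule.Quotient.induction_on with | _ a
    obtain ⟨n, hn, ha⟩ := h a.toMul
    refine ⟨⟨(n : ℤ), mem_nonZeroDivisors_of_ne_zero (by positivity)⟩, ?_⟩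
    rw [Submonoid.mk_smul, ← Submodule.Quotient.mk_smul, Submodule.Quotient.mk_eq_zero]
    rw [natCast_zsmul]
    exact ha
  rw [← rank_quotient_add_rank_of_isDomain M, hq, zero_add]
  exact Module.rank_lt_aleph0 ℤ M

/-- The range of `f` has the same rank as `M`, so by rank-nullity the kernel has rank zero, and it is
torsion-free. -/
theorem injective_of_finite_quotient_range {M : Type*} [AddCommGroup M]
    [Module.IsTorsionFree ℤ M]
    (hM : Module.rank ℤ M < ℵ₀) (f : M →ₗ[ℤ] M) [Finite (M ⧸ LinearMap.range f)] :
    Function.Injective f := by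
  have hq : Module.rank ℤ (M ⧸ LinearMap.range f) = 0 := by
    rw [Module.rank_eq_zero_iff_isTorsion]
    intro x
    refine ⟨⟨(Nat.card (M ⧸ LinearMap.range f) : ℤ),
      mem_nonZeroDivisors_of_ne_zero (by exact_mod_cast Nat.card_pos.ne')⟩, ?_⟩
    rw [Submonoid.mk_smul, natCast_zsmul]
    exact card_nsmul_eq_zero'
  have h1 := rank_quotient_add_rank_of_isDomain (LinearMap.range f)
  have h2 := f.rank_range_add_rank_ker
  rw [hq, zero_add] at h1
  rw [h1] at h2
  have h3 : Module.rank ℤ (LinearMap.ker f) = 0 := by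
    refine Cardinal.eq_of_add_eq_add_left (h2.trans (add_zero _).symm) hM
  rw [rank_zero_iff] at h3
  exact LinearMap.ker_eq_bot.1 (Submodule.eq_bot_of_subsingleton)

/-- The endomorphism `a ↦ a / φ a` of an abelian group; its cosets are the `φ`-conjugacy
classes. -/
def idDiv {A : Type*} [CommGroup A] (φ : A →* A) : A →* A := MonoidHom.id A / φ

theorem reidemeisterNumber_eq_card_quotient {A : Type*} [CommGroup A] (φ : A →* A) :
    reidemeisterNumber φ = ENat.card (A ⧸ (idDiv φ).range) := by
  refine ENat.card_congr (Quotient.congr (Equiv.refl A) fun x y => ?_)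
  change IsTwistedConj φ x y ↔ QuotientGroup.leftRel _ x y
  rw [QuotientGroup.leftRel_apply]
  constructor
  · rintro ⟨z, rfl⟩
    refine ⟨z⁻¹, ?_⟩
    change z⁻¹ / φ z⁻¹ = (z * y * (φ z)⁻¹)⁻¹ * y
    rw [map_inv, mul_right_comm z, mul_inv, inv_mul_cancel_right, mul_inv, div_eq_mul_inv]
  · rintro ⟨z, hz⟩
    refine ⟨z⁻¹, ?_⟩
    have hz' : z * (φ z)⁻¹ = x⁻¹ * y := by simpa [idDiv, div_eq_mul_inv] using hz
    obtain rfl : y = x * (z * (φ z)⁻¹) := by rw [hz']; simp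
    change x = z⁻¹ * (x * (z * (φ z)⁻¹)) * (φ z⁻¹)⁻¹
    rw [map_inv, inv_inv, mul_left_comm x, inv_mul_cancel_left, inv_mul_cancel_right]

/-- For a torsion-free abelian group of finite rank, an endomorphism with finite Reidemeister number
has no nontrivial fixed points. -/
theorem idDiv_injective {A : Type*} [CommGroup A] (htf : ∀ a : A, IsOfFinOrder a → a = 1)
    (hA : Module.rank ℤ (Additive A) < ℵ₀) {φ : A →* A} (hφ : reidemeisterNumber φ ≠ ⊤) :
    Function.Injective (idDiv φ) := by
  let f : Additive A →ₗ[ℤ] Additive A := (idDiv φ).toAdditive.toIntLinearMap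
  have : IsMulTorsionFree A := by
    rw [isMulTorsionFree_iff_not_isOfFinOrder]
    exact fun a ha h => ha (htf a h)
  have hfin : Finite (A ⧸ (idDiv φ).range) := by
    rw [reidemeisterNumber_eq_card_quotient] at hφ
    by_contra h
    rw [not_finite_iff_infinite] at h
    exact hφ ENat.card_eq_top_of_infinite
  have : Finite (Additive A ⧸ LinearMap.range f) := hfin
  exact injective_of_finite_quotient_range hA f

/-- For nonempty types the junk value `Nat.card = 0` occurs exactly for infinite types, so `Nat.card`
determines `ENat.card`. -/
theorem enatCard_eq_of_natCard_eq {α β : Type*} [Nonempty α] [Nonempty β]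
    (h : Nat.card α = Nat.card β) : ENat.card α = ENat.card β := by
  rcases finite_or_infinite α with hα | hα
  · have : Finite β := Nat.finite_of_card_ne_zero (h ▸ Nat.card_pos.ne')
    rw [ENat.card_eq_coe_natCard, ENat.card_eq_coe_natCard, h]
  · have : Infinite β := by
      rw [← not_finite_iff_infinite]
      intro hβ
      exact Nat.card_pos.ne' (h ▸ Nat.card_eq_zero_of_infinite : Nat.card β = 0)
    simp

theorem reidemeisterNumber_restrictEnd_comm {A : Type*} [CommGroup A]
    (htf : ∀ a : A, IsOfFinOrder a → a = 1)
    (hA : Module.rank ℤ (Additive A) < ℵ₀) (φ : A →* A) (B : Subgroup A) [B.FiniteIndex]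
    (hB : B.map φ ≤ B) :
    reidemeisterNumber (restrictEnd φ B hB) = reidemeisterNumber φ := by
  have hval : ∀ b : B, ((idDiv (restrictEnd φ B hB) b : B) : A) = idDiv φ b := fun b => rfl
  have key (hinj : Function.Injective (idDiv φ)) :
      reidemeisterNumber (restrictEnd φ B hB) = reidemeisterNumber φ := by
    rw [reidemeisterNumber_eq_card_quotient, reidemeisterNumber_eq_card_quotient]
    refine enatCard_eq_of_natCard_eq ?_
    change (idDiv (restrictEnd φ B hB)).range.index = (idDiv φ).range.index
    have hmap : B.map (idDiv φ) = (idDiv (restrictEnd φ B hB)).range.map B.subtype := by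
      ext a
      constructor
      · rintro ⟨b, hb, rfl⟩
        exact ⟨_, ⟨⟨b, hb⟩, rfl⟩, rfl⟩
      · rintro ⟨_, ⟨b, rfl⟩, rfl⟩
        exact ⟨b, b.2, rfl⟩
    -- both sides times `[A : B]` equal the index in `A` of the image of `B` under `idDiv φ`
    have h1 := B.index_map_of_injective hinj
    rw [hmap, index_map_subtype, mul_comm] at h1
    exact Nat.eq_of_mul_eq_mul_left (Nat.pos_of_ne_zero FiniteIndex.index_ne_zero) h1
  by_cases h : reidemeisterNumber φ = ⊤
  · by_contra hne
    have hBfin : reidemeisterNumber (restrictEnd φ B hB) ≠ ⊤ := h ▸ hne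
    refine hne (key ?_)
    have hrank : Module.rank ℤ (Additive B) < ℵ₀ :=
      (LinearMap.rank_le_of_injective B.subtype.toAdditive.toIntLinearMap
        B.subtype_injective).trans_lt hA
    have hinjB := idDiv_injective
      (fun b hb => Subtype.ext (htf b (B.subtype.isOfFinOrder hb))) hrank hBfin
    rw [injective_iff_map_eq_one] at hinjB ⊢
    -- a power of any element lies in `B`, where `idDiv φ` is injective
    intro a ha
    have hm : a ^ B.index ∈ B := B.pow_index_mem a
    have h1 := hinjB ⟨_, hm⟩ (Subtype.ext (by rw [hval]; simp [ha]))
    exact htf a (isOfFinOrder_iff_pow_eq_one.2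
      ⟨B.index, Nat.pos_of_ne_zero FiniteIndex.index_ne_zero, congrArg Subtype.val h1⟩)
  · exact key (idDiv_injective htf hA h)

end Abelian

/-! ### Central isolators in torsion-free nilpotent groups -/

theorem commutatorElement_pow_left {G : Type*} [Group G] {x g : G} (h : Commute ⁅x, g⁆ x) (n : ℕ) :
    ⁅x ^ n, g⁆ = ⁅x, g⁆ ^ n := by
  have h1 : g * x⁻¹ * g⁻¹ = x⁻¹ * ⁅x, g⁆ := by simp [commutatorElement_def, mul_assoc]
  calc ⁅x ^ n, g⁆ = x ^ n * (g * x⁻¹ * g⁻¹) ^ n := by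
        rw [conj_pow, commutatorElement_def]; simp [mul_assoc]
    _ = ⁅x, g⁆ ^ n := by
        rw [h1, (h.inv_right.symm).mul_pow]; simp

/-- The factors of the upper central series of a torsion-free group are torsion-free. For `x` in the
`(i + 2)`-nd term and any `g`, the commutator `⁅x, g⁆` inherits the root property one step lower. -/
theorem mem_upperCentralSeries_of_pow_mem {G : Type*} [Group G]
    (htf : ∀ g : G, IsOfFinOrder g → g = 1) {n : ℕ} (hn : 0 < n) (i : ℕ) :
    ∀ x ∈ Subgroup.upperCentralSeries G (i + 1), x ^ n ∈ Subgroup.upperCentralSeries G i →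
      x ∈ Subgroup.upperCentralSeries G i := by
  induction i with
  | zero =>
    intro x _ hx
    rw [Subgroup.upperCentralSeries_zero, mem_bot] at hx ⊢
    exact htf x (isOfFinOrder_iff_pow_eq_one.2 ⟨n, hn, hx⟩)
  | succ i ih =>
    intro x hx hxn
    rw [Subgroup.mem_upperCentralSeries_succ_iff] at hx hxn ⊢
    intro g
    refine ih _ (hx g) ?_
    -- modulo the `i`-th term, `⁅x, g⁆` is central, so `⁅x, g⁆ ^ n = ⁅x ^ n, g⁆`
    let p := QuotientGroup.mk' (Subgroup.upperCentralSeries G i)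
    have hcomm : Commute ⁅p x, p g⁆ (p x) := by
      rw [← commutatorElement_eq_one_iff_commute, ← map_commutatorElement, ← map_commutatorElement]
      exact (QuotientGroup.eq_one_iff _).2 ((Subgroup.mem_upperCentralSeries_succ_iff).1 (hx g) x)
    refine (QuotientGroup.eq_one_iff _).1 (?_ : p (⁅x, g⁆ ^ n) = 1)
    rw [map_pow, map_commutatorElement, ← commutatorElement_pow_left hcomm, ← map_pow,
      ← map_commutatorElement]
    exact (QuotientGroup.eq_one_iff _).2 (hxn g)

/-- In a torsion-free nilpotent group the centre is isolated. -/
theorem mem_center_of_pow_mem {G : Type*} [Group G] [Group.IsNilpotent G]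
    (htf : ∀ g : G, IsOfFinOrder g → g = 1) {n : ℕ} (hn : 0 < n) {x : G}
    (hx : x ^ n ∈ center G) : x ∈ center G := by
  rw [← Subgroup.upperCentralSeries_one] at hx ⊢
  have key : ∀ j, x ∈ Subgroup.upperCentralSeries G (j + 1) →
      x ∈ Subgroup.upperCentralSeries G 1 := by
    intro j
    induction j with
    | zero => exact id
    | succ j ih =>
      exact fun h => ih (mem_upperCentralSeries_of_pow_mem htf hn (j + 1) x h
        (Subgroup.upperCentralSeries_mono G (by lia) hx))
  obtain ⟨k, hk⟩ := Group.IsNilpotent.nilpotent G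
  exact key k (Subgroup.upperCentralSeries_mono G k.le_succ (hk ▸ mem_top x))

/-- The central elements having a positive power in `L`. -/
def centralIsolator {G : Type*} [Group G] (L : Subgroup G) : Subgroup G where
  carrier := {x | x ∈ center G ∧ ∃ n, 0 < n ∧ x ^ n ∈ L}
  one_mem' := ⟨one_mem _, 1, one_pos, by simp⟩
  mul_mem' := by
    rintro x y ⟨hx, m, hm, hxm⟩ ⟨hy, n, hn, hyn⟩
    refine ⟨mul_mem hx hy, m * n, Nat.mul_pos hm hn, ?_⟩
    have hxy : Commute x y := mem_center_iff.1 hy x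
    rw [hxy.mul_pow, pow_mul, mul_comm m n, pow_mul]
    exact mul_mem (pow_mem hxm n) (pow_mem hyn m)
  inv_mem' := by
    rintro x ⟨hx, m, hm, hxm⟩
    exact ⟨inv_mem hx, m, hm, by rw [inv_pow]; exact inv_mem hxm⟩

theorem centralIsolator_le_center {G : Type*} [Group G] (L : Subgroup G) :
    centralIsolator L ≤ center G := fun _ hx => hx.1

instance centralIsolator_normal {G : Type*} [Group G] (L : Subgroup G) :
    (centralIsolator L).Normal :=
  ⟨fun x hx g => by rwa [mem_center_iff.1 hx.1 g, mul_inv_cancel_right]⟩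

/-- In a finitely generated group each factor of the lower central series is finitely generated: if
`S` generates the `k`-th factor and `T` generates the group, the commutators `⁅s, t⁆` generate the
next factor. -/
theorem exists_finite_generators_lowerCentralSeries (G : Type*) [Group G] [Group.FG G] (k : ℕ) :
    ∃ S : Set G, S.Finite ∧ S ⊆ Subgroup.lowerCentralSeries (⊤ : Subgroup G) k ∧
      Subgroup.lowerCentralSeries (⊤ : Subgroup G) k ≤
        closure S ⊔ Subgroup.lowerCentralSeries (⊤ : Subgroup G) (k + 1) := by
  obtain ⟨T, hT, hTfin⟩ := Group.fg_iff.1 (inferInstance : Group.FG G)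
  induction k with
  | zero => exact ⟨T, hTfin, fun _ _ => mem_top _, hT ▸ le_sup_left⟩
  | succ k ih =>
    obtain ⟨S, hSfin, hS, hle⟩ := ih
    set L := Subgroup.lowerCentralSeries (⊤ : Subgroup G)
    let S' : Set G := Set.image2 (fun s t => ⁅s, t⁆) S T
    have hS' : S' ⊆ L (k + 1) := by
      rintro _ ⟨s, hs, t, -, rfl⟩
      exact commutator_mem_commutator (hS hs) (mem_top t)
    refine ⟨S', hSfin.image2 _ hTfin, hS', ?_⟩
    let M := closure S' ⊔ L (k + 2)
    have hM : M ≤ L (k + 1) :=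
      sup_le ((closure_le _).2 hS') (Subgroup.lowerCentralSeries_antitone _ (by lia))
    have hcomm : ∀ x ∈ L (k + 1), ∀ g, ⁅x, g⁆ ∈ M := fun x hx g =>
      (le_sup_right : L (k + 2) ≤ M) (commutator_mem_commutator hx (mem_top g))
    have hMn : M.Normal := ⟨fun x hx g => by
      have h := M.mul_mem (M.inv_mem (hcomm x (hM hx) g)) hx
      simpa [commutatorElement_def, mul_assoc] using h⟩
    let p := QuotientGroup.mk' M
    have hp : ∀ x g : G, ⁅x, g⁆ ∈ M ↔ Commute (p x) (p g) := fun x g => by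
      rw [← commutatorElement_eq_one_iff_commute, ← map_commutatorElement]
      exact (QuotientGroup.eq_one_iff _).symm
    -- modulo `M` the generators `S` are central, hence so is the whole `k`-th term
    have hcen : L k ≤ (center (G ⧸ M)).comap p := by
      refine hle.trans (sup_le ((closure_le _).2 fun s hs => ?_) fun x hx => ?_)
      · have : (⊤ : Subgroup G) ≤ (centralizer {p s}).comap p := by
          rw [← hT, closure_le]
          intro t ht
          refine mem_centralizer_singleton_iff.2 ?_
          exact ((hp s t).1 ((le_sup_left : closure S' ≤ M)
            (subset_closure ⟨s, hs, t, ht, rfl⟩))).eq.symm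
        refine mem_center_iff.2 fun g => ?_
        obtain ⟨g, rfl⟩ := QuotientGroup.mk'_surjective M g
        exact mem_centralizer_singleton_iff.1 (this (mem_top g))
      · refine mem_center_iff.2 fun g => ?_
        obtain ⟨g, rfl⟩ := QuotientGroup.mk'_surjective M g
        exact ((hp x g).1 (hcomm x hx g)).eq.symm
    change ⁅L k, ⊤⁆ ≤ M
    rw [commutator_le]
    exact fun x hx g _ => (hp x g).2 (mem_center_iff.1 (hcen hx) (p g)).symm

theorem fg_lowerCentralSeries_of_succ_eq_bot {G : Type*} [Group G] [Group.FG G] {k : ℕ}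
    (hk : Subgroup.lowerCentralSeries (⊤ : Subgroup G) (k + 1) = ⊥) :
    (Subgroup.lowerCentralSeries (⊤ : Subgroup G) k).FG := by
  obtain ⟨S, hfin, hS, hle⟩ := exists_finite_generators_lowerCentralSeries G k
  rw [hk, sup_bot_eq] at hle
  exact (Subgroup.fg_iff _).2 ⟨S, le_antisymm ((closure_le _).2 hS) hle, hfin⟩

/-- The data for the induction step: a central `φ`-invariant subgroup `Z` of finite rank with
torsion-free quotient, in which the lower central series is shorter by one step. Finite rank is
expressed by `Z` being torsion over a finitely generated subgroup. -/
theorem exists_central_reduction {G : Type*} [Group G] [Group.FG G]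
    (htf : ∀ g : G, IsOfFinOrder g → g = 1) {k : ℕ}
    (hk : Subgroup.lowerCentralSeries (⊤ : Subgroup G) (k + 1) = ⊥) (φ : G →* G) :
    ∃ (Z : Subgroup G) (_ : Z.Normal), Z ≤ center G ∧ Z.map φ ≤ Z ∧
      (∃ B : Subgroup Z, B.FG ∧ ∀ a : Z, ∃ n, 0 < n ∧ a ^ n ∈ B) ∧
      (∀ q : G ⧸ Z, IsOfFinOrder q → q = 1) ∧
      Subgroup.lowerCentralSeries (⊤ : Subgroup (G ⧸ Z)) k = ⊥ := by
  have : Group.IsNilpotent G := Subgroup.nilpotent_iff_lowerCentralSeries.2 ⟨_, hk⟩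
  set L := Subgroup.lowerCentralSeries (⊤ : Subgroup G) k with hL
  have hLc : L ≤ center G := by
    rw [← commutator_top_right_eq_bot_iff_le_center]
    exact hk
  have hLZ : L ≤ centralIsolator L := fun x hx => ⟨hLc hx, 1, one_pos, by simpa using hx⟩
  have hroot : ∀ (x : G) (n : ℕ), 0 < n → x ^ n ∈ L → x ∈ centralIsolator L :=
    fun x n hn hx => ⟨mem_center_of_pow_mem htf hn (hLc hx), n, hn, hx⟩
  have hφL : L.map φ ≤ L := by
    rw [hL, map_lowerCentralSeries]
    exact Subgroup.lowerCentralSeries_mono _ le_top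
  refine ⟨centralIsolator L, inferInstance, centralIsolator_le_center L, ?_, ?_, ?_, ?_⟩
  · rintro _ ⟨x, ⟨-, n, hn, hx⟩, rfl⟩
    exact hroot _ n hn (by rw [← map_pow]; exact hφL (mem_map_of_mem φ hx))
  · refine ⟨L.subgroupOf (centralIsolator L), ?_, ?_⟩
    · have := fg_lowerCentralSeries_of_succ_eq_bot hk
      rw [← Group.fg_iff_subgroup_fg] at this ⊢
      exact Group.fg_of_surjective (f := (subgroupOfEquivOfLe hLZ).symm.toMonoidHom)
        (subgroupOfEquivOfLe hLZ).symm.surjective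
    · rintro ⟨a, ha, n, hn, han⟩
      exact ⟨n, hn, han⟩
  · intro q hq
    obtain ⟨x, rfl⟩ := QuotientGroup.mk'_surjective _ q
    obtain ⟨n, hn, hx⟩ := isOfFinOrder_iff_pow_eq_one.1 hq
    rw [← map_pow] at hx
    obtain ⟨-, m, hm, hxm⟩ := (QuotientGroup.eq_one_iff _).1 hx
    rw [← pow_mul] at hxm
    exact (QuotientGroup.eq_one_iff _).2 (hroot x _ (Nat.mul_pos hn hm) hxm)
  · rw [← map_top_of_surjective _ (QuotientGroup.mk'_surjective (centralIsolator L)),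
      ← map_lowerCentralSeries, Subgroup.map_eq_bot_iff, QuotientGroup.ker_mk']
    exact hLZ

/-! ### Induction along the lower central series -/

/-- If `R(φ)` is finite, then all stabilizers of the `φ`-twisted conjugation action are trivial. -/
theorem twistedStabilizer_eq_one {k : ℕ} : ∀ {G : Type*} [Group G] [Group.FG G]
    (_ : ∀ g : G, IsOfFinOrder g → g = 1) (_ : Subgroup.lowerCentralSeries (⊤ : Subgroup G) k = ⊥)
    (φ : G →* G) (_ : reidemeisterNumber φ ≠ ⊤) (x g : G), g * x * (φ g)⁻¹ = x → g = 1 := by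
  induction k with
  | zero =>
    intro G _ _ _ hk φ _ x g _
    exact mem_bot.1 (hk ▸ mem_top g)
  | succ k ih =>
    intro G _ _ htf hk φ hφ x g hg
    obtain ⟨Z, _, hZc, hφZ, ⟨B, hB, hpow⟩, htfQ, hkQ⟩ := exists_central_reduction htf hk φ
    let ψ : G ⧸ Z →* G ⧸ Z := QuotientGroup.map Z Z φ (map_le_iff_le_comap.1 hφZ)
    let π := QuotientGroup.mk' Z
    have hπ : Function.Surjective π := QuotientGroup.mk'_surjective Z
    have hψ : reidemeisterNumber ψ ≠ ⊤ :=
      ((reidemeisterNumber_le_of_surjective π hπ fun _ => rfl).trans_lt hφ.lt_top).ne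
    have hstab := ih htfQ hkQ ψ hψ
    have hprod := reidemeisterNumber_eq_mul π hπ (fun _ => rfl) hstab (QuotientGroup.ker_mk' Z)
      hZc hφZ
    have hZ : reidemeisterNumber (restrictEnd φ Z hφZ) ≠ ⊤ := by
      intro h
      rw [h, ENat.mul_top] at hprod
      · exact hφ hprod
      · exact (ENat.card_ne_zero_iff_nonempty _).2 ⟨⟦1⟧⟩
    have hgZ : g ∈ Z := (QuotientGroup.eq_one_iff g).1 (hstab (π x) (π g) (congrArg π hg))
    let _ : CommGroup Z :=
      { (inferInstance : Group Z) with
        mul_comm := fun a b => Subtype.ext (mem_center_iff.1 (hZc b.2) a) }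
    have hinj := idDiv_injective (φ := restrictEnd φ Z hφZ)
      (fun b hb => Subtype.ext (htf b (Z.subtype.isOfFinOrder hb)))
      (rank_int_lt_aleph0_of_pow_mem_fg hB hpow) hZ
    have hfix : g * (φ g)⁻¹ = 1 := by
      rw [← mem_center_iff.1 (hZc hgZ) x, mul_assoc] at hg
      exact mul_eq_left.1 hg
    have h1 : idDiv (restrictEnd φ Z hφZ) ⟨g, hgZ⟩ = 1 :=
      Subtype.ext (by
        change g / φ g = 1
        rw [div_eq_mul_inv, hfix])
    exact congrArg Subtype.val ((injective_iff_map_eq_one _).1 hinj _ h1)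

theorem reidemeisterNumber_restrictEnd {k : ℕ} : ∀ {G : Type*} [Group G] [Group.FG G]
    (_ : ∀ g : G, IsOfFinOrder g → g = 1) (_ : Subgroup.lowerCentralSeries (⊤ : Subgroup G) k = ⊥)
    (H : Subgroup G) [H.FiniteIndex] (φ : G →* G) (hφ : H.map φ ≤ H),
    reidemeisterNumber (restrictEnd φ H hφ) = reidemeisterNumber φ := by
  induction k with
  | zero =>
    intro G _ _ _ hk H _ φ hφ
    have hG : ∀ g : G, g = 1 := fun g => mem_bot.1 (hk ▸ mem_top g)
    exact reidemeisterNumber_congr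
      (MulEquiv.ofBijective H.subtype
        ⟨H.subtype_injective, fun g => ⟨1, by rw [hG g, map_one]⟩⟩) fun _ => rfl
  | succ k ih =>
    intro G _ _ htf hk H _ φ hφ
    obtain ⟨Z, _, hZc, hφZ, ⟨B, hB, hpow⟩, htfQ, hkQ⟩ := exists_central_reduction htf hk φ
    let ψ : G ⧸ Z →* G ⧸ Z := QuotientGroup.map Z Z φ (map_le_iff_le_comap.1 hφZ)
    let π := QuotientGroup.mk' Z
    have hπ : Function.Surjective π := QuotientGroup.mk'_surjective Z
    have hker : π.ker = Z := QuotientGroup.ker_mk' Z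
    have hψH : (H.map π).map ψ ≤ H.map π := by
      rintro _ ⟨_, ⟨h, hh, rfl⟩, rfl⟩
      exact ⟨φ h, hφ (mem_map_of_mem φ hh), rfl⟩
    have : (H.map π).FiniteIndex :=
      ⟨fun h => FiniteIndex.index_ne_zero (H := H)
        (Nat.eq_zero_of_zero_dvd (h ▸ H.index_map_dvd hπ))⟩
    have hQ := ih htfQ hkQ (H.map π) ψ hψH
    have hπH := π.subgroupMap_surjective H
    by_cases hψ : reidemeisterNumber ψ = ⊤
    · -- both numbers are bounded below by those of the quotients
      have h1 := reidemeisterNumber_le_of_surjective (φ := φ) (ψ := ψ) π hπ fun _ => rfl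
      have h2 := reidemeisterNumber_le_of_surjective (φ := restrictEnd φ H hφ)
        (ψ := restrictEnd ψ (H.map π) hψH) (π.subgroupMap H) hπH fun _ => rfl
      rw [hQ] at h2
      rw [hψ, top_le_iff] at h1 h2
      rw [h1, h2]
    have hstab := twistedStabilizer_eq_one htfQ hkQ ψ hψ
    have hZH : (Z.subgroupOf H).map (restrictEnd φ H hφ) ≤ Z.subgroupOf H := by
      rintro _ ⟨h, hh, rfl⟩
      exact hφZ (mem_map_of_mem φ hh)
    have hHZ : (H.subgroupOf Z).map (restrictEnd φ Z hφZ) ≤ H.subgroupOf Z := by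
      rintro _ ⟨h, hh, rfl⟩
      exact hφ (mem_map_of_mem φ hh)
    rw [reidemeisterNumber_eq_mul (ψ := ψ) π hπ (fun _ => rfl) hstab hker hZc hφZ,
      reidemeisterNumber_eq_mul (ψ := restrictEnd ψ (H.map π) hψH) (π.subgroupMap H) hπH
        (fun _ => rfl)
        (fun x g hg => Subtype.ext (hstab x g (congrArg Subtype.val hg)))
        (by rw [ker_subgroupMap, hker])
        (fun x hx => mem_center_iff.2 fun y => Subtype.ext (mem_center_iff.1 (hZc hx) y)) hZH,
      hQ]
    congr 1
    let _ : CommGroup Z :=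
      { (inferInstance : Group Z) with
        mul_comm := fun a b => Subtype.ext (mem_center_iff.1 (hZc b.2) a) }
    rw [← reidemeisterNumber_restrictEnd_comm
      (fun b hb => Subtype.ext (htf b (Z.subtype.isOfFinOrder hb)))
      (rank_int_lt_aleph0_of_pow_mem_fg hB hpow) (restrictEnd φ Z hφZ) (H.subgroupOf Z) hHZ]
    -- both sides live on `H ∩ Z`, seen inside `H` and inside `Z`
    exact reidemeisterNumber_congr
      { toFun := fun x => ⟨⟨x, x.2⟩, x.1.2⟩
        invFun := fun x => ⟨⟨x, x.2⟩, x.1.2⟩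
        left_inv := fun _ => rfl
        right_inv := fun _ => rfl
        map_mul' := fun _ _ => rfl } fun _ => rfl

end TwistedConjugacy

theorem mainTheorem1 {N : Type*} [Group N] [Group.FG N] [Group.IsNilpotent N]
    (htf : ∀ g : N, IsOfFinOrder g → g = 1)
    (H : Subgroup N) [H.FiniteIndex]
    (φ : N →* N) (hφ : H.map φ ≤ H) :
    TwistedConjugacy.reidemeisterNumber (TwistedConjugacy.restrictEnd φ H hφ) =
      TwistedConjugacy.reidemeisterNumber φ := by
  obtain ⟨k, hk⟩ := Subgroup.nilpotent_iff_lowerCentralSeries.1 ‹Group.IsNilpotent N›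
  exact TwistedConjugacy.reidemeisterNumber_restrictEnd htf hk H φ hφ
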